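/- Let $d \ge 1$ and $0 \le k \le d-1$ be integers, and let $\nu$ be a tempered measure on $\mathbb{R}^d$, i.e. a (non-negative) Borel measure for which there are $N \in \mathbb{N}$ and $C < \infty$ with $\nu(B_R(0)) \le C R^N$ for all $R \ge 1$, where $B_r(x)$ denotes the closed Euclidean ball. Let $\operatorname{spec}\nu$ be the support of the Fourier transform of $\nu$ (in the sense of tempered distributions), and let $L \subset \mathbb{R}^d$ be a $k$-dimensional linear subspace. If the set $$\{\zeta \in S^{d-1} : \exists\, \lambda > 0 \text{ such that } \lambda\zeta \in \operatorname{spec}\nu\}$$ does not intersect some neighborhood of $L \cap S^{d-1}$, then for every $x \in \mathbb{R}^d$ $$\liminf_{r \to 0+} \frac{\log \nu(B_r(x))}{\log r} \ge k,$$ that is, the local lower Hausdorff dimension of $\nu$ at $x$ is at least $k$. (The quotient is read as $+\infty$ when $\nu(B_r(x)) = 0$, so the bound is trivial at points outside the support of $\nu$.) -/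

import Mathlib

open MeasureTheory Filter Metric
open scoped Topology ENNReal NNReal SchwartzMap FourierTransform

/-- A tempered measure on `ℝ^d`: a Borel measure with `ν (B_R(0)) ≤ C R ^ N` for all `R ≥ 1`, for
some exponent `N ∈ ℕ` and some finite constant `C`. In particular `ν` is finite on every ball, hence
locally finite. -/
class IsTemperedMeasure {d : ℕ} (ν : Measure (EuclideanSpace ℝ (Fin d))) : Prop where
  exists_growth : ∃ (N : ℕ) (C : ℝ≥0), ∀ R : ℝ, 1 ≤ R →
    ν (closedBall 0 R) ≤ C * ENNReal.ofReal R ^ N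

/-- A tempered measure integrates some power `(1 + ‖x‖) ^ (-n)`, so that integration against it is
a tempered distribution. -/
instance IsTemperedMeasure.hasTemperateGrowth {d : ℕ} (ν : Measure (EuclideanSpace ℝ (Fin d)))
    [h : IsTemperedMeasure ν] : ν.HasTemperateGrowth := by
  obtain ⟨N, C, hC⟩ := h.exists_growth
  refine ⟨N + 2, ?_, ?_⟩
  · have : Continuous fun x : EuclideanSpace ℝ (Fin d) => (1 + ‖x‖) ^ (-((N + 2 : ℕ) : ℝ)) :=
      (continuous_const.add continuous_norm).rpow_const fun x =>
        Or.inl (by have := norm_nonneg x; simp only [Pi.add_apply]; linarith)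
    exact this.aestronglyMeasurable
  have hshell : ∀ x : EuclideanSpace ℝ (Fin d),
      ‖(1 + ‖x‖) ^ (-((N + 2 : ℕ) : ℝ))‖ₑ ≤ ∑' j : ℕ, (closedBall (0 : EuclideanSpace ℝ (Fin d))
        ((j : ℝ) + 1)).indicator (fun _ => ENNReal.ofReal (((j : ℝ) + 1) ^ (N + 2))⁻¹) x := by
    intro x
    refine le_trans ?_ (ENNReal.le_tsum ⌊‖x‖⌋₊)
    have hx : x ∈ closedBall (0 : EuclideanSpace ℝ (Fin d)) ((⌊‖x‖⌋₊ : ℝ) + 1) := by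
      simpa using (Nat.lt_floor_add_one ‖x‖).le
    rw [Set.indicator_of_mem hx, Real.enorm_eq_ofReal (by positivity)]
    apply ENNReal.ofReal_le_ofReal
    rw [Real.rpow_neg (by positivity), Real.rpow_natCast]
    have := Nat.floor_le (norm_nonneg x)
    gcongr ?_⁻¹
    exact pow_le_pow_left₀ (by positivity) (by linarith) _
  have hterm : ∀ j : ℕ, ENNReal.ofReal (((j : ℝ) + 1) ^ (N + 2))⁻¹ *
      ν (closedBall 0 ((j : ℝ) + 1)) ≤ C * ENNReal.ofReal (1 / ((j : ℝ) + 1) ^ 2) := by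
    intro j
    have hj : (0 : ℝ) < (j : ℝ) + 1 := by positivity
    calc _ ≤ ENNReal.ofReal (((j : ℝ) + 1) ^ (N + 2))⁻¹ *
          (C * ENNReal.ofReal ((j : ℝ) + 1) ^ N) := by
          gcongr
          exact hC _ (by simp)
      _ = C * ENNReal.ofReal (1 / ((j : ℝ) + 1) ^ 2) := by
          rw [← ENNReal.ofReal_pow hj.le, mul_left_comm, ← ENNReal.ofReal_mul (by positivity)]
          congr 2
          field_simp
          ring
  have hsum : Summable fun j : ℕ => 1 / ((j : ℝ) + 1) ^ 2 := by
    simpa using (summable_nat_add_iff 1).2 (Real.summable_one_div_nat_pow.2 one_lt_two)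
  refine lt_of_le_of_lt (lintegral_mono hshell) ?_
  rw [lintegral_tsum fun j => (measurable_const.indicator measurableSet_closedBall).aemeasurable]
  simp_rw [lintegral_indicator_const measurableSet_closedBall]
  refine lt_of_le_of_lt (ENNReal.tsum_le_tsum hterm) ?_
  rw [ENNReal.tsum_mul_left]
  exact ENNReal.mul_lt_top ENNReal.coe_lt_top hsum.tsum_ofReal_lt_top

/-- The spectrum of a tempered measure: the support of its (distributional) Fourier transform. -/
noncomputable def fourierSpectrum {d : ℕ} (ν : Measure (EuclideanSpace ℝ (Fin d)))
    [IsTemperedMeasure ν] : Set (EuclideanSpace ℝ (Fin d)) :=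
  Distribution.dsupport (𝓕 ν.toTemperedDistribution : 𝓢'(EuclideanSpace ℝ (Fin d), ℂ))

/-- The directions `ζ ∈ S^{d-1}` such that the open ray through `ζ` meets the spectrum. -/
def spectralDirections {d : ℕ} (ν : Measure (EuclideanSpace ℝ (Fin d)))
    [IsTemperedMeasure ν] : Set (EuclideanSpace ℝ (Fin d)) :=
  {ζ | ζ ∈ sphere 0 1 ∧ ∃ r : ℝ, 0 < r ∧ r • ζ ∈ fourierSpectrum ν}

/-- The local lower Hausdorff dimension `liminf_{r → 0+} log ν(B_r(x)) / log r` of a measure at `x`,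
with `B_r(x)` the closed ball. It is an extended real; `log 0 = -∞`, so it is `+∞` at points outside
the support of `ν`. -/
noncomputable def localLowerHausdorffDim {d : ℕ} (ν : Measure (EuclideanSpace ℝ (Fin d)))
    (x : EuclideanSpace ℝ (Fin d)) : EReal :=
  liminf (fun r : ℝ => ENNReal.log (ν (closedBall x r)) / (Real.log r : EReal)) (𝓝[>] 0)

open scoped ContDiff Manifold

/-! Test the spectrum on boxes elongated along `L`. Take `ψ` of compact support with `𝓕 ψ`
nonnegative and bounded below near 0, and let `A r` scale `L` by `r` and fix `Lᗮ`. The function `φ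
r`, equal to `ψ ∘ A r` modulated by `x`, has Fourier transform `r⁻ᵏ 𝓕 ψ ((A r)⁻¹ (y - x))`, which is
nonnegative, and at least `c r⁻ᵏ` on a ball of radius `r ρ` about `x`. Hence `c r⁻ᵏ ν(B)` is at most
the pairing of `𝓕 ν` with `φ r`.

This pairing stays bounded as `r → 0`. The support of `φ r` lies in a tube around `L` independent of
`r`, and the spectral cone, bounded away from the directions of `L`, meets this tube in a bounded
set. A fixed cutoff therefore does not change the pairing, and the cut-off functions form a bounded
family of Schwartz functions. So `ν(B) = O(rᵏ)`; logarithms finish. -/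

/-- A tempered distribution vanishes on compactly supported test functions whose support does not
meet the support of the distribution. -/
theorem TemperedDistribution.apply_eq_zero_of_disjoint_dsupport {E F : Type*}
    [NormedAddCommGroup E] [NormedSpace ℝ E] [FiniteDimensional ℝ E]
    [NormedAddCommGroup F] [NormedSpace ℂ F] (T : 𝓢'(E, F)) (u : 𝓢(E, ℂ))
    (hu : HasCompactSupport u) (hd : Disjoint (tsupport u) (Distribution.dsupport T)) :
    T u = 0 := by
  have hloc : ∀ p : tsupport u, ∃ s : Set E,
      Distribution.IsVanishingOn T s ∧ IsOpen s ∧ (p : E) ∈ s := fun p =>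
    (Distribution.notMem_dsupport_iff _).1 (Set.disjoint_left.1 hd p.2)
  choose U hUv hUo hUm using hloc
  obtain ⟨t, ht⟩ := hu.isCompact.elim_finite_subcover U hUo
    fun p hp => Set.mem_iUnion.2 ⟨⟨p, hp⟩, hUm _⟩
  have ht' : tsupport u ⊆ ⋃ i : t, U i := by simpa [Set.iUnion_subtype] using ht
  obtain ⟨f, hf⟩ := SmoothPartitionOfUnity.exists_isSubordinate 𝓘(ℝ, E) (isClosed_tsupport u)
    (fun i : t => U i) (fun i => hUo i) ht'
  have hsupp : ∀ i : t, HasCompactSupport fun x => (f i x : ℂ) * u x := fun i => hu.mul_left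
  have hsm : ∀ i : t, ContDiff ℝ ∞ fun x => (f i x : ℂ) * u x := fun i =>
    (Complex.ofRealCLM.contDiff.comp (f i).contMDiff.contDiff).mul (u.smooth ⊤)
  -- The partition of unity splits `u` into finitely many pieces, each supported where `T` vanishes.
  have hsum : u = ∑ i : t, (hsupp i).toSchwartzMap (hsm i) := by
    ext x
    rw [sum_apply]
    simp only [HasCompactSupport.toSchwartzMap_toFun, ← Finset.sum_mul]
    by_cases hx : x ∈ tsupport u
    · have h1 := f.sum_eq_one hx
      rw [finsum_eq_sum_of_fintype] at h1
      rw [← Complex.ofReal_sum, h1, Complex.ofReal_one, one_mul]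
    · rw [image_eq_zero_of_notMem_tsupport hx, mul_zero]
  rw [hsum, map_sum]
  refine Finset.sum_eq_zero fun i _ => hUv i _ (subset_trans ?_ (hf i))
  refine closure_mono fun x hx => ?_
  simp only [Function.mem_support, HasCompactSupport.toSchwartzMap_toFun] at hx ⊢
  exact fun h => hx (by simp [h])

/-! ### Fourier transforms of rescaled and positive test functions -/

section Fourier

variable {E : Type*} [NormedAddCommGroup E] [InnerProductSpace ℝ E] [FiniteDimensional ℝ E]
  [MeasurableSpace E] [BorelSpace E]

theorem integral_comp_continuousLinearEquiv {F : Type*} [NormedAddCommGroup F] [NormedSpace ℝ F]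
    (A : E ≃L[ℝ] E) (g : E → F) :
    ∫ x, g (A x) = |(LinearMap.det (A : E →ₗ[ℝ] E))⁻¹| • ∫ x, g x := by
  have h := Measure.map_linearMap_addHaar_eq_smul_addHaar (volume : Measure E)
    (f := (A : E →ₗ[ℝ] E)) (LinearEquiv.isUnit_det' A.toLinearEquiv).ne_zero
  have h2 := A.toHomeomorph.measurableEmbedding.integral_map (μ := volume) g
  have h3 : Measure.map (A.toHomeomorph) (volume : Measure E) =
    Measure.map (A : E →ₗ[ℝ] E) volume := rfl
  rw [h3, h, integral_smul_measure, ENNReal.toReal_ofReal (abs_nonneg _)] at h2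
  exact h2.symm

open scoped RealInnerProductSpace in
/-- The Fourier transform of a modulated linear rescaling. -/
theorem fourier_modulate_comp (A : E ≃L[ℝ] E) (hA : ∀ v w, ⟪A v, w⟫ = ⟪v, A w⟫) (f : E → ℂ)
    (x y : E) :
    𝓕 (fun ξ => (𝐞 ⟪x, ξ⟫ : ℂ) * f (A ξ)) y =
      |(LinearMap.det (A : E →ₗ[ℝ] E))⁻¹| • 𝓕 f (A.symm (y - x)) := by
  rw [Real.fourier_eq, Real.fourier_eq, ← integral_comp_continuousLinearEquiv A]
  refine integral_congr_ae (Eventually.of_forall fun ξ => ?_)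
  simp only [Circle.smul_def, smul_eq_mul, ← mul_assoc]
  rw [hA, A.apply_symm_apply, inner_sub_right, neg_sub, sub_eq_neg_add, AddChar.map_add_eq_mul,
    Circle.coe_mul, real_inner_comm x ξ]

/-- Conjugation inverts the character, and the substitution `ξ ↦ -ξ` undoes this. -/
theorem conj_fourier_of_even_real {f : E → ℂ} (hreal : ∀ x, (starRingEnd ℂ) (f x) = f x)
    (heven : ∀ x, f (-x) = f x) (y : E) : (starRingEnd ℂ) (𝓕 f y) = 𝓕 f y := by
  rw [Real.fourier_eq, ← integral_conj, ← integral_neg_eq_self]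
  refine integral_congr_ae (Eventually.of_forall fun ξ => ?_)
  simp [Circle.smul_def, hreal, heven, ← Circle.coe_inv_eq_conj, AddChar.map_neg_eq_inv]

/-- There is a compactly supported smooth function whose Fourier transform is nonnegative and
bounded below near the origin. -/
theorem exists_hasCompactSupport_fourier_nonneg :
    ∃ ψ : 𝓢(E, ℂ), HasCompactSupport ψ ∧ ∃ g : E → ℝ, (∀ y, 𝓕 (ψ : E → ℂ) y = g y) ∧ (∀ y, 0 ≤ g y) ∧
      ∃ ρ > 0, ∃ c > 0, ∀ y, ‖y‖ ≤ ρ → c ≤ g y := by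
  let β : ContDiffBump (0 : E) := ⟨1, 2, by norm_num, by norm_num⟩
  have hb : HasCompactSupport fun x => (β x : ℂ) :=
    β.hasCompactSupport.comp_left (g := Complex.ofReal) Complex.ofReal_zero
  have hs : ContDiff ℝ ∞ fun x => (β x : ℂ) := Complex.ofRealCLM.contDiff.comp β.contDiff
  let b : 𝓢(E, ℂ) := hb.toSchwartzMap hs
  -- Self-convolution squares the transform, which is real because the bump is real and even; hence
  -- nonnegativity.
  let ψ := SchwartzMap.convolution (ContinuousLinearMap.mul ℂ ℂ) b b
  have hψ : (ψ : E → ℂ) = convolution b b (ContinuousLinearMap.mul ℂ ℂ) volume :=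
    funext fun x => SchwartzMap.convolution_apply _ _ _ _
  have hF : ∀ y, 𝓕 (ψ : E → ℂ) y = 𝓕 (b : E → ℂ) y * 𝓕 (b : E → ℂ) y := fun y => by
    rw [hψ, Real.fourier_mul_convolution_eq b.integrable b.integrable]
  have hre : ∀ y, ((𝓕 (b : E → ℂ) y).re : ℂ) = 𝓕 (b : E → ℂ) y := fun y =>
    Complex.conj_eq_iff_re.1 (conj_fourier_of_even_real (by simp [b]) (by simp [b, β.neg]) y)
  refine ⟨ψ, ?_, fun y => (𝓕 (b : E → ℂ) y).re ^ 2, fun y => ?_, fun y => sq_nonneg _, ?_⟩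
  · rw [hψ]
    exact hb.convolution _ hb
  · rw [hF, Complex.ofReal_pow, hre, sq]
  · have hc : Continuous fun y => (𝓕 (b : E → ℂ) y).re ^ 2 := by
      rw [← SchwartzMap.fourier_coe]
      exact (Complex.continuous_re.comp (𝓕 b).continuous).pow 2
    have h0 : 0 < (𝓕 (b : E → ℂ) 0).re ^ 2 := by
      have : 𝓕 (b : E → ℂ) 0 = ((∫ x, β x : ℝ) : ℂ) := by
        rw [Real.fourier_eq]
        simp [b, integral_complex_ofReal]
      rw [this, Complex.ofReal_re]
      exact pow_pos β.integral_pos 2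
    obtain ⟨ρ, hρ, h⟩ := Metric.nhds_basis_closedBall.eventually_iff.1
      (hc.continuousAt.eventually (lt_mem_nhds (half_lt_self h0)))
    exact ⟨ρ, hρ, _, half_pos h0, fun y hy => (h (by simpa using hy)).le⟩

end Fourier

/-! ### Dilations along `L` and the geometry of cones -/

section Dilation

variable {E : Type*} [NormedAddCommGroup E] [InnerProductSpace ℝ E] [FiniteDimensional ℝ E]

/-- The map that scales `L` by `r` and fixes the orthogonal complement of `L`. -/
noncomputable def partialDilationMap (L : Submodule ℝ E) (r : ℝ) : E →L[ℝ] E :=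
  r • L.starProjection + Lᗮ.starProjection

theorem partialDilationMap_apply (L : Submodule ℝ E) (r : ℝ) (v : E) :
    partialDilationMap L r v = r • L.starProjection v + Lᗮ.starProjection v := rfl

theorem starProjection_partialDilationMap (L : Submodule ℝ E) (r : ℝ) (v : E) :
    L.starProjection (partialDilationMap L r v) = r • L.starProjection v := by
  rw [partialDilationMap_apply, map_add, map_smul,
    Submodule.starProjection_eq_self_iff.2 (L.starProjection_apply_mem v),
    L.starProjection_apply_eq_zero_iff.2 (Lᗮ.starProjection_apply_mem v), add_zero]

theorem starProjection_orthogonal_partialDilationMap (L : Submodule ℝ E) (r : ℝ) (v : E) :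
    Lᗮ.starProjection (partialDilationMap L r v) = Lᗮ.starProjection v := by
  rw [partialDilationMap_apply, map_add, map_smul,
    Submodule.starProjection_eq_self_iff.2 (Lᗮ.starProjection_apply_mem v),
    Submodule.starProjection_orthogonal_apply_eq_zero (L.starProjection_apply_mem v), smul_zero,
    zero_add]

theorem partialDilationMap_mul_apply (L : Submodule ℝ E) {r s : ℝ} (h : r * s = 1) (v : E) :
    partialDilationMap L r (partialDilationMap L s v) = v := by
  rw [partialDilationMap_apply, starProjection_partialDilationMap,
    starProjection_orthogonal_partialDilationMap, smul_smul, h, one_smul,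
    Submodule.starProjection_add_starProjection_orthogonal]

/-- `partialDilationMap` as a continuous linear equivalence. -/
noncomputable def partialDilation (L : Submodule ℝ E) {r : ℝ} (hr : r ≠ 0) : E ≃L[ℝ] E :=
  ContinuousLinearEquiv.equivOfInverse (partialDilationMap L r) (partialDilationMap L r⁻¹)
    (partialDilationMap_mul_apply L (inv_mul_cancel₀ hr))
    (partialDilationMap_mul_apply L (mul_inv_cancel₀ hr))

theorem inner_partialDilationMap (L : Submodule ℝ E) (r : ℝ) (v w : E) :
    inner ℝ (partialDilationMap L r v) w = inner ℝ v (partialDilationMap L r w) := by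
  simp only [partialDilationMap_apply, inner_add_left, inner_add_right, real_inner_smul_left,
    real_inner_smul_right, Submodule.inner_starProjection_left_eq_right]

theorem norm_sq_partialDilationMap (L : Submodule ℝ E) (r : ℝ) (v : E) :
    ‖partialDilationMap L r v‖ ^ 2 =
      r ^ 2 * ‖L.starProjection v‖ ^ 2 + ‖Lᗮ.starProjection v‖ ^ 2 := by
  rw [Submodule.norm_sq_eq_add_norm_sq_starProjection _ L, starProjection_partialDilationMap,
    starProjection_orthogonal_partialDilationMap, norm_smul, mul_pow, Real.norm_eq_abs, sq_abs]

theorem norm_partialDilationMap_apply_le (L : Submodule ℝ E) {r s : ℝ} (hrs : |r| ≤ s) (hs : 1 ≤ s)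
    (v : E) : ‖partialDilationMap L r v‖ ≤ s * ‖v‖ := by
  refine (pow_le_pow_iff_left₀ (norm_nonneg _)
    (mul_nonneg (zero_le_one.trans hs) (norm_nonneg v)) two_ne_zero).1 ?_
  rw [norm_sq_partialDilationMap, mul_pow, Submodule.norm_sq_eq_add_norm_sq_starProjection v L,
    mul_add]
  have h1 : r ^ 2 ≤ s ^ 2 := sq_le_sq' (by linarith [neg_le_of_abs_le hrs]) ((le_abs_self r).trans hrs)
  have h2 : 1 ≤ s ^ 2 := one_le_pow₀ hs
  gcongr
  nlinarith [sq_nonneg ‖Lᗮ.starProjection v‖]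

theorem norm_starProjection_orthogonal_le (L : Submodule ℝ E) (r : ℝ) (v : E) :
    ‖Lᗮ.starProjection v‖ ≤ ‖partialDilationMap L r v‖ := by
  rw [← starProjection_orthogonal_partialDilationMap L r v]
  exact Lᗮ.norm_starProjection_apply_le _

theorem det_partialDilationMap (L : Submodule ℝ E) (r : ℝ) :
    LinearMap.det (partialDilationMap L r : E →ₗ[ℝ] E) = r ^ Module.finrank ℝ L := by
  let e := L.prodEquivOfIsCompl _ L.isCompl_orthogonal
  have h : (partialDilationMap L r : E →ₗ[ℝ] E) =
      (e : (L × Lᗮ) →ₗ[ℝ] E) ∘ₗ ((r • LinearMap.id : L →ₗ[ℝ] L).prodMap LinearMap.id) ∘ₗ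
        (e.symm : E →ₗ[ℝ] L × Lᗮ) := by
    ext v
    obtain ⟨⟨a, b⟩, rfl⟩ := e.surjective v
    have ha : L.starProjection (a : E) = a := Submodule.starProjection_eq_self_iff.2 a.2
    have hb' : L.starProjection (b : E) = 0 := L.starProjection_apply_eq_zero_iff.2 b.2
    simp [partialDilationMap_apply, e, ha, hb']
  rw [h, LinearMap.det_conj, LinearMap.det_prodMap, LinearMap.det_smul, LinearMap.det_id,
    LinearMap.det_id, mul_one, mul_one]

/-- A cone that avoids a neighborhood of the directions of `L` meets every tubular neighborhood
of `L` in a bounded set. -/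
theorem exists_norm_le_of_directions_disjoint (L : Submodule ℝ E) {S U : Set E}
    (hU : U ∈ 𝓝ˢ ((L : Set E) ∩ sphere 0 1))
    (hS : Disjoint {ζ : E | ζ ∈ sphere 0 1 ∧ ∃ r : ℝ, 0 < r ∧ r • ζ ∈ S} U) (R : ℝ) :
    ∃ M : ℝ, ∀ ξ ∈ S, ‖Lᗮ.starProjection ξ‖ ≤ R → ‖ξ‖ ≤ M := by
  have hK : IsCompact ((L : Set E) ∩ sphere 0 1) :=
    (isCompact_sphere (0 : E) 1).inter_left L.closed_of_finiteDimensional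
  obtain ⟨V, hVo, hKV, hVU⟩ := mem_nhdsSet_iff_exists.1 hU
  obtain ⟨δ, hδ, hδV⟩ := hK.exists_thickening_subset_open hVo hKV
  -- Beyond `R` the projection of `ξ` to `L` is nonzero; beyond `2 * R / δ` the directions of `ξ`
  -- and of its projection are within `δ`.
  refine ⟨max R (2 * R / δ), fun ξ hξ hR => ?_⟩
  by_contra! hlt
  have hR0 : 0 ≤ R := (norm_nonneg _).trans hR
  have hξR : R < ‖ξ‖ := (le_max_left _ _).trans_lt hlt
  have hξδ : 2 * R < ‖ξ‖ * δ := (div_lt_iff₀ hδ).1 ((le_max_right _ _).trans_lt hlt)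
  have hξ0 : 0 < ‖ξ‖ := hR0.trans_lt hξR
  set p := L.starProjection ξ with hp
  have hdec : p + Lᗮ.starProjection ξ = ξ := L.starProjection_add_starProjection_orthogonal ξ
  have hp0 : 0 < ‖p‖ := by
    have := norm_add_le p (Lᗮ.starProjection ξ)
    rw [hdec] at this
    linarith
  have hmem : ‖p‖⁻¹ • p ∈ (L : Set E) ∩ sphere 0 1 :=
    ⟨L.smul_mem _ (L.starProjection_apply_mem ξ), by
      rw [mem_sphere_zero_iff_norm, norm_smul, norm_inv, norm_norm, inv_mul_cancel₀ hp0.ne']⟩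
  have hdist : dist (‖ξ‖⁻¹ • ξ) (‖p‖⁻¹ • p) < δ := by
    have hsub : ‖ξ - p‖ ≤ R := by
      rw [← hdec, add_sub_cancel_left]
      exact hR
    have heq : ‖ξ‖ • (‖ξ‖⁻¹ • ξ - ‖p‖⁻¹ • p) = (ξ - p) - ((‖ξ‖ - ‖p‖) * ‖p‖⁻¹) • p := by
      rw [smul_sub, smul_smul, smul_smul, mul_inv_cancel₀ hξ0.ne', sub_mul,
        mul_inv_cancel₀ hp0.ne', sub_smul]
      simp
    have hn : ‖ξ‖ * dist (‖ξ‖⁻¹ • ξ) (‖p‖⁻¹ • p) ≤ 2 * R := by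
      calc ‖ξ‖ * dist (‖ξ‖⁻¹ • ξ) (‖p‖⁻¹ • p)
          = ‖(ξ - p) - ((‖ξ‖ - ‖p‖) * ‖p‖⁻¹) • p‖ := by
            rw [← heq, norm_smul, norm_norm, dist_eq_norm]
        _ ≤ ‖ξ - p‖ + |‖ξ‖ - ‖p‖| := by
            refine (norm_sub_le _ _).trans_eq ?_
            rw [norm_smul, norm_mul, norm_inv, norm_norm, mul_assoc, inv_mul_cancel₀ hp0.ne',
              mul_one, Real.norm_eq_abs]
        _ ≤ 2 * R := by linarith [abs_norm_sub_norm_le ξ p]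
    exact lt_of_mul_lt_mul_left (hn.trans_lt hξδ) hξ0.le
  refine Set.disjoint_left.1 hS ⟨?_, ‖ξ‖, hξ0, ?_⟩
    (hVU (hδV (mem_thickening_iff.2 ⟨_, hmem, hdist⟩)))
  · rw [mem_sphere_zero_iff_norm, norm_smul, norm_inv, norm_norm, inv_mul_cancel₀ hξ0.ne']
  · rwa [smul_smul, mul_inv_cancel₀ hξ0.ne', one_smul]

end Dilation

/-! ### Boundedness in Schwartz space -/

/-- A tempered functional is uniformly bounded on products of a fixed test function with
compositions of another one with linear contractions. -/
theorem SchwartzMap.exists_norm_apply_mul_comp_le {E ι : Type*} [NormedAddCommGroup E]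
    [NormedSpace ℝ E] (T : 𝓢(E, ℂ) →L[ℂ] ℂ) (u ψ : 𝓢(E, ℂ)) (w : ι → 𝓢(E, ℂ))
    (A : ι → E →L[ℝ] E) (hA : ∀ i, ‖A i‖ ≤ 1) (hw : ∀ i ξ, w i ξ = u ξ * ψ (A i ξ)) :
    ∃ C : ℝ, ∀ i, ‖T (w i)‖ ≤ C := by
  have hcomp : ∀ (i : ι) (j : ℕ) (ξ : E),
      ‖iteratedFDeriv ℝ j (ψ ∘ A i) ξ‖ ≤ SchwartzMap.seminorm ℝ 0 j ψ := fun i j ξ => by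
    rw [(A i).iteratedFDeriv_comp_right (ψ.smooth ⊤) ξ (mod_cast le_top)]
    refine (ContinuousMultilinearMap.norm_compContinuousLinearMap_le _ _).trans ?_
    rw [Finset.prod_const]
    exact (mul_le_of_le_one_right (norm_nonneg _) (pow_le_one₀ (norm_nonneg _) (hA i))).trans
      (SchwartzMap.norm_iteratedFDeriv_le_seminorm ℝ ψ j _)
  -- By Leibniz, the polynomial weight is absorbed by `u` alone, so `ψ ∘ A i` needs only sup bounds
  -- on its derivatives.
  have hb : Bornology.IsVonNBounded ℂ (w '' Set.univ) := by
    rw [(schwartz_withSeminorms ℂ E ℂ).image_isVonNBounded_iff_seminorm_bounded]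
    rintro ⟨k, n⟩
    let B : ℝ := ∑ j ∈ Finset.range (n + 1),
      n.choose j * SchwartzMap.seminorm ℝ k j u * SchwartzMap.seminorm ℝ 0 (n - j) ψ
    have hB : 0 ≤ B := Finset.sum_nonneg fun j _ => by positivity
    refine ⟨B + 1, by positivity, fun i _ => lt_of_le_of_lt ?_ (lt_add_one B)⟩
    refine SchwartzMap.seminorm_le_bound ℂ k n (w i) hB fun ξ => ?_
    have hwi : (w i : E → ℂ) = fun ξ => u ξ * (ψ ∘ A i) ξ := funext (hw i)
    have h := norm_iteratedFDeriv_mul_le (𝕜 := ℝ) (u.smooth ⊤)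
      ((ψ.smooth ⊤).comp (A i).contDiff) ξ (n := n) (mod_cast le_top)
    rw [hwi]
    refine (mul_le_mul_of_nonneg_left h (by positivity)).trans ?_
    rw [Finset.mul_sum]
    refine Finset.sum_le_sum fun j _ => ?_
    rw [← mul_assoc, mul_left_comm]
    gcongr
    · exact SchwartzMap.le_seminorm ℝ k j u ξ
    · exact hcomp i _ ξ
  obtain ⟨C, hC⟩ := ((NormedSpace.isVonNBounded_iff ℂ).1 (hb.image T)).exists_norm_le
  exact ⟨C, fun i => hC _ ⟨_, ⟨i, trivial, rfl⟩, rfl⟩⟩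

/-! ### Mass of small balls and local dimension -/

theorem IsTemperedMeasure.measure_closedBall_lt_top {d : ℕ}
    (ν : Measure (EuclideanSpace ℝ (Fin d))) [h : IsTemperedMeasure ν]
    (x : EuclideanSpace ℝ (Fin d)) (s : ℝ) : ν (closedBall x s) < ⊤ := by
  obtain ⟨N, C, hC⟩ := h.exists_growth
  have hsub : closedBall x s ⊆ closedBall 0 (max 1 (s + ‖x‖)) :=
    closedBall_subset_closedBall' (by rw [dist_zero_right]; exact le_max_right _ _)
  refine (measure_mono hsub).trans_lt ((hC _ (le_max_left _ _)).trans_lt ?_)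
  exact ENNReal.mul_lt_top ENNReal.coe_lt_top (ENNReal.pow_lt_top ENNReal.ofReal_lt_top)

/-- If the spectral directions of a tempered measure avoid a neighborhood of the directions of `L`,
then the mass of a ball of radius `r` is at most of order `r ^ dim L`. -/
theorem IsTemperedMeasure.exists_measureReal_closedBall_le {d : ℕ}
    (ν : Measure (EuclideanSpace ℝ (Fin d))) [IsTemperedMeasure ν]
    (L : Submodule ℝ (EuclideanSpace ℝ (Fin d)))
    (hspec : ∃ U ∈ 𝓝ˢ ((L : Set (EuclideanSpace ℝ (Fin d))) ∩ sphere 0 1),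
      Disjoint (spectralDirections ν) U)
    (x : EuclideanSpace ℝ (Fin d)) :
    ∃ ρ > 0, ∃ C > 0, ∀ r : ℝ, 0 < r → r ≤ 1 →
      ν.real (closedBall x (r * ρ)) ≤ C * r ^ Module.finrank ℝ L := by
  obtain ⟨U, hU, hdisj⟩ := hspec
  obtain ⟨ψ, hψ, g, hg, hg0, ρ, hρ, c, hc, hgc⟩ :=
    exists_hasCompactSupport_fourier_nonneg (E := EuclideanSpace ℝ (Fin d))
  obtain ⟨R, hR⟩ := hψ.isCompact.isBounded.exists_norm_le
  obtain ⟨M, hM⟩ := exists_norm_le_of_directions_disjoint L hU hdisj R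
  let χ : ContDiffBump (0 : EuclideanSpace ℝ (Fin d)) :=
    ⟨max M 0 + 1, max M 0 + 2, by positivity, by linarith⟩
  let e : EuclideanSpace ℝ (Fin d) → ℂ := fun ξ => (𝐞 (inner ℝ x ξ) : ℂ)
  have he : ContDiff ℝ ∞ e := by
    simp only [e, Real.fourierChar_apply]
    refine Complex.contDiff_exp.comp ((Complex.ofRealCLM.contDiff.comp ?_).mul contDiff_const)
    exact contDiff_const.mul (contDiff_const.inner ℝ contDiff_id)
  let A : Set.Ioc (0 : ℝ) 1 → EuclideanSpace ℝ (Fin d) ≃L[ℝ] EuclideanSpace ℝ (Fin d) :=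
    fun r => partialDilation L r.2.1.ne'
  have hφs : ∀ r, HasCompactSupport fun ξ => e ξ * ψ (A r ξ) := fun r =>
    (hψ.comp_homeomorph (A r).toHomeomorph).mul_left
  have hφd : ∀ r, ContDiff ℝ ∞ fun ξ => e ξ * ψ (A r ξ) := fun r =>
    he.mul ((ψ.smooth ⊤).comp (A r).contDiff)
  have hχd : ContDiff ℝ ∞ fun ξ => (χ ξ : ℂ) := Complex.ofRealCLM.contDiff.comp χ.contDiff
  have hus : HasCompactSupport fun ξ => (χ ξ : ℂ) * e ξ :=
    (χ.hasCompactSupport.comp_left (g := Complex.ofReal) Complex.ofReal_zero).mul_right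
  let φ := fun r => (hφs r).toSchwartzMap (hφd r)
  let u := hus.toSchwartzMap (hχd.mul he)
  have hws : ∀ r, HasCompactSupport fun ξ => (χ ξ : ℂ) * e ξ * ψ (A r ξ) := fun r => hus.mul_right
  let w := fun r => (hws r).toSchwartzMap ((hχd.mul he).mul ((ψ.smooth ⊤).comp (A r).contDiff))
  let T : 𝓢(EuclideanSpace ℝ (Fin d), ℂ) →L[ℂ] ℂ :=
    SchwartzMap.integralCLM ℂ ν ∘L FourierTransform.fourierCLM ℂ _
  have hT : ∀ v, T v = ∫ y, 𝓕 (v : EuclideanSpace ℝ (Fin d) → ℂ) y ∂ν := fun v => by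
    rw [← SchwartzMap.fourier_coe]
    rfl
  obtain ⟨C, hC⟩ := SchwartzMap.exists_norm_apply_mul_comp_le T u ψ w
    (fun r => (A r : EuclideanSpace ℝ (Fin d) →L[ℝ] EuclideanSpace ℝ (Fin d)))
    (fun r => ContinuousLinearMap.opNorm_le_bound _ zero_le_one fun v =>
      norm_partialDilationMap_apply_le L (by rw [abs_of_pos r.2.1]; exact r.2.2) le_rfl v)
    (fun r ξ => rfl)
  -- A spectral point in the support of `φ r - w r` would lie in the tube, so have norm at most `M`;
  -- but `χ = 1` near such points.
  have hTφ : ∀ r, T (φ r) = T (w r) := fun r => by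
    rw [← sub_eq_zero, ← map_sub]
    have happ : ∀ ξ, (φ r - w r) ξ = (1 - (χ ξ : ℂ)) * (e ξ * ψ (A r ξ)) := fun ξ => by
      change e ξ * ψ (A r ξ) - (χ ξ : ℂ) * e ξ * ψ (A r ξ) = _
      ring
    have hsub : tsupport (φ r - w r) ⊆ {ξ | ‖A r ξ‖ ≤ R} := by
      refine closure_minimal (fun ξ hξ => hR _ (subset_tsupport _ fun h0 => hξ ?_))
        (isClosed_le (A r).continuous.norm continuous_const)
      rw [happ, h0, mul_zero, mul_zero]
    refine TemperedDistribution.apply_eq_zero_of_disjoint_dsupport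
      (𝓕 ν.toTemperedDistribution) (φ r - w r) ((hφs r).sub (hws r)) ?_
    rw [Set.disjoint_left]
    intro ξ hξ hξs
    have hξM := hM ξ hξs ((norm_starProjection_orthogonal_le L r ξ).trans (hsub hξ))
    refine notMem_tsupport_iff_eventuallyEq.2 ?_ hξ
    have hball : ball (0 : EuclideanSpace ℝ (Fin d)) (max M 0 + 1) ∈ 𝓝 ξ :=
      isOpen_ball.mem_nhds (by
        rw [mem_ball_zero_iff]
        linarith [le_max_left M 0])
    filter_upwards [hball] with η hη
    rw [happ, χ.one_of_mem_closedBall (ball_subset_closedBall hη), Complex.ofReal_one, sub_self,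
      zero_mul]
    rfl
  -- `max C 1` makes the constant positive, so that its logarithm can be taken later.
  refine ⟨ρ, hρ, (max C 1) / c, by positivity, fun r hr0 hr1 => ?_⟩
  let s : Set.Ioc (0 : ℝ) 1 := ⟨r, hr0, hr1⟩
  set k := Module.finrank ℝ L
  let f : EuclideanSpace ℝ (Fin d) → ℝ := fun y => (r ^ k)⁻¹ * g ((A s).symm (y - x))
  have hf : ∀ y, 𝓕 (φ s : EuclideanSpace ℝ (Fin d) → ℂ) y = f y := fun y => by
    have h := fourier_modulate_comp (A s) (inner_partialDilationMap L r) ψ x y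
    have hdet : LinearMap.det ((A s : EuclideanSpace ℝ (Fin d) →L[ℝ] EuclideanSpace ℝ (Fin d)) :
        EuclideanSpace ℝ (Fin d) →ₗ[ℝ] EuclideanSpace ℝ (Fin d)) = r ^ k :=
      det_partialDilationMap L r
    refine h.trans ?_
    rw [hg, Complex.real_smul, ← Complex.ofReal_mul]
    congr 3
    exact (congrArg (fun t : ℝ => |t⁻¹|) hdet).trans (abs_of_pos (by positivity))
  have hf0 : ∀ y, 0 ≤ f y := fun y => mul_nonneg (by positivity) (hg0 _)
  have hfint : Integrable f ν := by
    have h := ((𝓕 (φ s)).integrable (μ := ν)).re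
    refine h.congr (Eventually.of_forall fun y => ?_)
    change ((𝓕 (φ s)) y).re = f y
    rw [SchwartzMap.fourier_coe, hf, Complex.ofReal_re]
  have hint : ∫ y, f y ∂ν ≤ max C 1 := by
    have h := hC s
    rw [← hTφ, hT, integral_congr_ae (Eventually.of_forall hf), integral_complex_ofReal,
      Complex.norm_real] at h
    exact (le_abs_self _).trans (h.trans (le_max_left _ _))
  have hball : closedBall x (r * ρ) ⊆ {y | (r ^ k)⁻¹ * c ≤ f y} := fun y hy => by
    refine mul_le_mul_of_nonneg_left (hgc _ ?_) (by positivity)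
    have h1 : ‖(A s).symm (y - x)‖ ≤ r⁻¹ * ‖y - x‖ :=
      norm_partialDilationMap_apply_le L (abs_of_pos (inv_pos.2 hr0)).le (one_le_inv₀ hr0 |>.2 hr1) _
    rw [mem_closedBall, dist_eq_norm] at hy
    calc _ ≤ r⁻¹ * ‖y - x‖ := h1
      _ ≤ r⁻¹ * (r * ρ) := by gcongr
      _ = ρ := by field_simp
  have hchain : (r ^ k)⁻¹ * c * ν.real (closedBall x (r * ρ)) ≤ max C 1 := by
    refine le_trans ?_ hint
    rw [mul_comm, ← smul_eq_mul, ← setIntegral_const]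
    refine (setIntegral_mono_on (integrableOn_const
      (IsTemperedMeasure.measure_closedBall_lt_top ν x _).ne) hfint.integrableOn
      measurableSet_closedBall fun y hy => hball hy).trans ?_
    exact setIntegral_le_integral hfint (Eventually.of_forall hf0)
  rw [div_mul_eq_mul_div, le_div_iff₀ hc]
  calc ν.real (closedBall x (r * ρ)) * c
      = ((r ^ k)⁻¹ * c * ν.real (closedBall x (r * ρ))) * r ^ k := by field_simp
    _ ≤ max C 1 * r ^ k := by gcongr

/-- After division by `log r`, the multiplicative constant contributes a term tending to 0. -/
theorem le_localLowerHausdorffDim_of_measureReal_le {d k : ℕ}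
    (ν : Measure (EuclideanSpace ℝ (Fin d))) [IsTemperedMeasure ν]
    (x : EuclideanSpace ℝ (Fin d)) {ρ C : ℝ} (hρ : 0 < ρ) (hC : 0 < C)
    (h : ∀ r : ℝ, 0 < r → r ≤ 1 → ν.real (closedBall x (r * ρ)) ≤ C * r ^ k) :
    (k : EReal) ≤ localLowerHausdorffDim ν x := by
  have hD : 0 < C / ρ ^ k := by positivity
  have hlim : Tendsto (fun r : ℝ => (((Real.log (C / ρ ^ k) / Real.log r + k : ℝ)) : EReal))
      (𝓝[>] 0) (𝓝 (k : EReal)) := by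
    have h0 : Tendsto (fun r : ℝ => Real.log (C / ρ ^ k) / Real.log r + k) (𝓝[>] 0) (𝓝 (0 + k)) :=
      (Real.tendsto_log_nhdsGT_zero.const_div_atBot _).add_const _
    rw [zero_add] at h0
    exact (continuous_coe_real_ereal.tendsto _).comp h0
  rw [localLowerHausdorffDim, ← hlim.liminf_eq]
  refine liminf_le_liminf ?_
  -- `r < 1` makes `log r` negative, so dividing by it reverses the inequality; `r < ρ` lets `h`
  -- apply at `r / ρ`.
  filter_upwards [Ioo_mem_nhdsGT (lt_min one_pos hρ)] with r hr
  have hr1 : r < 1 := hr.2.trans_le (min_le_left _ _)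
  have hlog : Real.log r < 0 := Real.log_neg hr.1 hr1
  have hreal : ν.real (closedBall x r) ≤ C / ρ ^ k * r ^ k := by
    have := h (r / ρ) (div_pos hr.1 hρ) ((div_le_one hρ).2 (hr.2.le.trans (min_le_right _ _)))
    rw [div_mul_cancel₀ _ hρ.ne', div_pow] at this
    exact this.trans_eq (by ring)
  have hle : ENNReal.log (ν (closedBall x r)) ≤
      ((Real.log (C / ρ ^ k) + k * Real.log r : ℝ) : EReal) := by
    rw [← Real.log_pow, ← Real.log_mul hD.ne' (pow_pos hr.1 k).ne',
      ← ENNReal.log_ofReal_of_pos (mul_pos hD (pow_pos hr.1 k))]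
    refine ENNReal.log_monotone ?_
    rw [← ENNReal.ofReal_toReal (a := ν (closedBall x r)) (IsTemperedMeasure.measure_closedBall_lt_top ν x r).ne]
    exact ENNReal.ofReal_le_ofReal hreal
  refine le_trans (le_of_eq ?_)
    (EReal.div_le_div_right_of_nonpos (EReal.coe_nonpos.2 hlog.le) hle)
  rw [← EReal.coe_div, add_div, mul_div_cancel_right₀ _ hlog.ne]

theorem theorem1p3 {d k : ℕ} (hk : k < d)
    (ν : Measure (EuclideanSpace ℝ (Fin d))) [IsTemperedMeasure ν]
    (L : Submodule ℝ (EuclideanSpace ℝ (Fin d))) (hL : Module.finrank ℝ L = k)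
    (hspec : ∃ U ∈ 𝓝ˢ ((L : Set (EuclideanSpace ℝ (Fin d))) ∩ sphere 0 1),
      Disjoint (spectralDirections ν) U)
    (x : EuclideanSpace ℝ (Fin d)) :
    (k : EReal) ≤ localLowerHausdorffDim ν x := by
  obtain ⟨ρ, hρ, C, hC, h⟩ := IsTemperedMeasure.exists_measureReal_closedBall_le ν L hspec x
  rw [hL] at h
  exact le_localLowerHausdorffDim_of_measureReal_le ν x hρ hC h
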